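/- Let $0<\delta<1/2$. There are constants $c_1,c_2>0$, depending only on $\delta$, such that for every odd prime $p$, all integers $n$ and $d$ with $1\le d\le\delta n$, and every $j\in\mathbb{F}_p^*=\mathbb{F}_p\setminus\{0\}$, $$\Pr_{f}\bigl[\,|\mathrm{bias}_j(f)|>p^{-c_1 n/d}\,\bigr]\le p^{-c_2|\mathcal{M}_p(d,n)|}.$$ Here $\mathcal{M}_p(d,n)$ is the set of monic monomials $x_1^{e_1}\cdots x_n^{e_n}$ with $0\le e_i\le p-1$ for all $i$ and $e_1+\dots+e_n\le d$; the polynomial $f$ is chosen uniformly at random from $\mathcal{P}_p(d,n)$, the set of all $\mathbb{F}_p$-linear combinations of monomials in $\mathcal{M}_p(d,n)$ (that is, polynomials of total degree at most $d$ in $n$ variables over $\mathbb{F}_p$, of degree at most $p-1$ in each variable); and $$\mathrm{bias}_j(f)=\frac1{p^n}\sum_{x\in\mathbb{F}_p^n}\omega^{j\cdot f(x)},\qquad \omega=e^{2\pi i/p}.$$ -/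

import Mathlib

namespace RMBias

/-- The monic monomials of degree at most `d` in `n` variables over `F_p`, as exponent vectors.
Monomials are reduced: since `x ^ p = x` on `F_p`, every individual exponent is at most `p - 1`. -/
def monomials (p d n : ℕ) : Set (Fin n →₀ ℕ) :=
  {e | (∀ i, e i < p) ∧ ∑ i, e i ≤ d}

/-- The polynomials of degree at most `d` in `n` variables over `F_p`, reduced in the same sense
(each variable occurs with exponent at most `p - 1`), so that distinct elements are distinct
functions on `F_p ^ n`, i.e. distinct codewords of the Reed-Muller code. -/
def polys (p d n : ℕ) : Set (MvPolynomial (Fin n) (ZMod p)) :=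
  {f | (∀ i, f.degreeOf i < p) ∧ f.totalDegree ≤ d}

/-- The `j`-th order bias `p ^ (-n) * ∑ x, ω ^ (j * f x)` with `ω = exp (2 π i / p)`;
`ZMod.stdAddChar` is the additive character `a ↦ ω ^ a` of `F_p`, see `bias_eq`. -/
noncomputable def bias (p n : ℕ) [NeZero p] (j : ZMod p) (f : (Fin n → ZMod p) → ZMod p) : ℂ :=
  1 / (p : ℂ) ^ n * ∑ x : Fin n → ZMod p, ZMod.stdAddChar (j * f x)

/-- The probability that a uniformly random element of the finite set `S` satisfies `E`. -/
noncomputable def unifProb {α : Type*} (S : Set α) (E : α → Prop) : ℝ :=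
  ({x | x ∈ S ∧ E x}.ncard : ℝ) / (S.ncard : ℝ)

theorem bias_eq (p n : ℕ) [NeZero p] (j : ZMod p) (f : (Fin n → ZMod p) → ZMod p) :
    bias p n j f = 1 / (p : ℂ) ^ n * ∑ x : Fin n → ZMod p,
      Complex.exp (2 * Real.pi * Complex.I / p) ^ (j * f x).val := by
  unfold bias
  congr 1
  refine Finset.sum_congr rfl fun x _ => ?_
  rw [ZMod.stdAddChar_apply, ZMod.toCircle_apply, ← Complex.exp_nat_mul]
  congr 1
  ring

theorem monomials_finite (p d n : ℕ) : (monomials p d n).Finite := by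
  refine Set.Finite.of_injOn (f := fun e : Fin n →₀ ℕ => (e : Fin n → ℕ))
    (t := Set.Iic fun _ => p) ?_ (fun a _ b _ h => DFunLike.coe_injective h) (Set.finite_Iic _)
  intro e he i
  exact (he.1 i).le

theorem mem_polys_iff {p d n : ℕ} (hp : 0 < p) (f : MvPolynomial (Fin n) (ZMod p)) :
    f ∈ polys p d n ↔ ∀ e ∈ f.support, e ∈ monomials p d n := by
  simp only [polys, monomials, Set.mem_ofPred_eq, MvPolynomial.degreeOf_lt_iff hp,
    MvPolynomial.totalDegree, Finset.sup_le_iff]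
  constructor
  · rintro ⟨h1, h2⟩ e he
    refine ⟨fun i => h1 i e he, ?_⟩
    have := h2 e he
    rwa [Finsupp.sum_fintype _ _ (fun _ => rfl)] at this
  · intro h
    refine ⟨fun i e he => (h e he).1 i, fun e he => ?_⟩
    have := (h e he).2
    rwa [Finsupp.sum_fintype _ _ (fun _ => rfl)]


theorem polys_finite (p d n : ℕ) [NeZero p] : (polys p d n).Finite := by
  classical
  have := (monomials_finite p d n).to_subtype
  refine Set.Finite.of_injOn
    (f := fun f (e : monomials p d n) => MvPolynomial.coeff (e : Fin n →₀ ℕ) f)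
    (t := Set.univ) (fun _ _ => Set.mem_univ _) ?_ Set.finite_univ
  intro f hf g hg h
  rw [mem_polys_iff (NeZero.pos p)] at hf hg
  ext e
  by_cases he : e ∈ monomials p d n
  · exact congrFun h ⟨e, he⟩
  · rw [MvPolynomial.notMem_support_iff.1 fun h' => he (hf e h'),
      MvPolynomial.notMem_support_iff.1 fun h' => he (hg e h')]

end RMBias

/-
Averaging the `2t`-th power of the bias over the code of polynomials of degree `d` gives the
probability that a random signed sum of `2t` evaluation functionals vanishes on that code. Test such
a relation on the products `x i * g`, where `i` runs through `m` chosen variables and `g` through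
the polynomials of degree `d - 1` in the others: it becomes `m` linear relations between `2t` random
evaluation functionals of the smaller code, whose coefficients are, up to sign, the chosen
coordinates, uniform and independent of the points. If the functionals span a space of dimension at
least `R`, the `m` relations hold with probability at most `q ^ (-m * R)`.

That the span is rarely smaller is the heart of the matter. A subspace `W` of the dual code contains
few evaluation functionals: if it contained `q ^ r` of them, an affine map to `F ^ r`, seen as a
pairwise independent hash function, would send their points onto at least half of an information set
of the code in `r` variables, whence `dim W` would be at least half of the dimension of the latter.

With `m` of order `n / d`, `r = n - 2m` and `2t = 8R`, where `2R` is about the dimension of the code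
of degree `d - 1` in `r` variables, the exponent `m * R` is of the order of the number of monomials,
and Markov's inequality finishes the proof.
-/

namespace RMBias

open Finset Module

section Fibers

variable {G H : Type*} [AddGroup G] [AddGroup H] [Fintype G] [Fintype H] [DecidableEq H]

theorem card_fiber_mul_card_of_surjective (φ : G →+ H) (hφ : Function.Surjective φ) (y : H) :
    #{g | φ g = y} * Fintype.card H = Fintype.card G := by
  have hfib := card_eq_sum_card_fiberwise (s := univ) (t := univ) (f := φ) (by simp)
  rw [card_univ, sum_congr rfl fun z _ =>
    AddMonoidHom.card_fiber_eq_of_mem_range φ (hφ z) (hφ y)] at hfib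
  rw [hfib, sum_const, card_univ, smul_eq_mul, mul_comm]

end Fibers

section PairwiseUniform

variable {ι X Y : Type*} [Fintype ι] [Fintype Y] [DecidableEq Y]

/-- A finite family of functions `h i : X → Y`, thought of as a random hash function, is pairwise
uniform if, for `i` uniformly distributed, each value `h i x` is uniform in `Y` and any two values
at distinct points are independent. The probabilities are cleared of denominators. -/
structure IsPairwiseUniform (h : ι → X → Y) : Prop where
  card_eq_mul (x : X) (y : Y) : #{i | h i x = y} * Fintype.card Y = Fintype.card ι
  card_eq_and_eq_mul {x x' : X} (hx : x ≠ x') (y y' : Y) :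
    #{i | h i x = y ∧ h i x' = y'} * Fintype.card Y ^ 2 = Fintype.card ι

namespace IsPairwiseUniform

variable {h : ι → X → Y} (hh : IsPairwiseUniform h) {S : Finset X} (hS : #S = Fintype.card Y)
include hh hS

theorem sum_card_preimage (y : Y) : ∑ i, #{s ∈ S | h i s = y} = Fintype.card ι := by
  have : 0 < Fintype.card Y := Fintype.card_pos_iff.2 ⟨y⟩
  simp only [card_filter]
  rw [sum_comm]
  simp only [← card_filter]
  apply Nat.eq_of_mul_eq_mul_right this
  rw [sum_mul, sum_congr rfl fun s _ => hh.card_eq_mul s y, sum_const, hS, smul_eq_mul, mul_comm]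

theorem sum_card_preimage_sq_le (y : Y) :
    ∑ i, #{s ∈ S | h i s = y} ^ 2 ≤ 2 * Fintype.card ι := by
  classical
  have hY : 0 < Fintype.card Y := Fintype.card_pos_iff.2 ⟨y⟩
  have hexpand : ∑ i, #{s ∈ S | h i s = y} ^ 2 =
      ∑ s ∈ S, ∑ s' ∈ S, #{i | h i s = y ∧ h i s' = y} := by
    simp only [card_filter, sq, sum_mul_sum, ← ite_and, mul_ite, mul_one, mul_zero]
    rw [sum_comm]
    refine sum_congr rfl fun s _ => ?_
    rw [sum_comm]
    exact sum_congr rfl fun s' _ => sum_congr rfl fun i _ => by simp only [and_comm]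
  have hrow (s) (hs : s ∈ S) :
      (∑ s' ∈ S, #{i | h i s = y ∧ h i s' = y}) * Fintype.card Y ≤ 2 * Fintype.card ι := by
    have hoff : (∑ s' ∈ S.erase s, #{i | h i s = y ∧ h i s' = y}) * Fintype.card Y
        ≤ Fintype.card ι := by
      apply Nat.le_of_mul_le_mul_right _ hY
      rw [mul_assoc, ← sq, sum_mul, sum_congr rfl fun s' hs' =>
        hh.card_eq_and_eq_mul (ne_of_mem_erase hs').symm y y, sum_const, smul_eq_mul, mul_comm]
      exact Nat.mul_le_mul_left _ (card_erase_le.trans hS.le)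
    rw [← add_sum_erase _ _ hs, add_mul]
    simp only [and_self, hh.card_eq_mul s y]
    omega
  rw [hexpand]
  apply Nat.le_of_mul_le_mul_right _ hY
  rw [sum_mul]
  exact (sum_le_card_nsmul _ _ _ hrow).trans (by rw [hS, smul_eq_mul, mul_comm])

theorem card_le_two_mul_card_hit (y : Y) :
    Fintype.card ι ≤ 2 * #{i | ∃ s ∈ S, h i s = y} := by
  have hpt (i : ι) : 3 * #{s ∈ S | h i s = y} ≤
      2 * (if ∃ s ∈ S, h i s = y then 1 else 0) + #{s ∈ S | h i s = y} ^ 2 := by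
    split_ifs with hit
    · generalize #{s ∈ S | h i s = y} = c
      rcases le_or_gt c 1 with hc | hc
      · interval_cases c <;> norm_num
      · nlinarith
    · rw [filter_eq_empty_iff.2 fun s hs hsy => hit ⟨s, hs, hsy⟩]
      simp
  have hsum := sum_le_sum fun i (_ : i ∈ univ) => hpt i
  rw [sum_add_distrib, ← mul_sum, ← mul_sum, ← card_filter, hh.sum_card_preimage hS] at hsum
  have := hh.sum_card_preimage_sq_le hS y
  omega

theorem exists_card_le_two_mul_card_hit [Nonempty ι] (I : Finset Y) :
    ∃ i, #I ≤ 2 * #{y ∈ I | ∃ s ∈ S, h i s = y} := by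
  by_contra! hlt
  have hrows : ∑ i, 2 * #{y ∈ I | ∃ s ∈ S, h i s = y} < ∑ _i : ι, #I :=
    sum_lt_sum_of_nonempty univ_nonempty fun i _ => hlt i
  have hcols : ∑ _y ∈ I, Fintype.card ι ≤ ∑ y ∈ I, 2 * #{i | ∃ s ∈ S, h i s = y} :=
    sum_le_sum fun y _ => hh.card_le_two_mul_card_hit hS y
  have hswap : ∑ i, #{y ∈ I | ∃ s ∈ S, h i s = y} =
      ∑ y ∈ I, #{i | ∃ s ∈ S, h i s = y} := by
    simp only [card_filter]
    exact sum_comm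
  rw [← mul_sum, hswap, sum_const, card_univ, smul_eq_mul] at hrows
  rw [← mul_sum, sum_const, smul_eq_mul, mul_comm] at hcols
  exact hrows.not_ge hcols

end IsPairwiseUniform

open Matrix in
theorem isPairwiseUniform_affine {F σ τ : Type*} [Field F] [Fintype F] [DecidableEq F] [Fintype σ]
    [DecidableEq σ] [Fintype τ] [DecidableEq τ] :
    IsPairwiseUniform fun (π : Matrix τ σ F × (τ → F)) (x : σ → F) => π.1 *ᵥ x + π.2 where
  card_eq_mul x y := by
    let φ : Matrix τ σ F × (τ → F) →+ (τ → F) :=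
      AddMonoidHom.mk' (fun π => π.1 *ᵥ x + π.2) fun π π' => by
        simp only [Prod.fst_add, Prod.snd_add, add_mulVec]; abel
    exact card_fiber_mul_card_of_surjective φ (fun z => ⟨(0, z), by simp [φ]⟩) y
  card_eq_and_eq_mul {x x'} hx y y' := by
    let φ : Matrix τ σ F × (τ → F) →+ (τ → F) × (τ → F) :=
      AddMonoidHom.mk' (fun π => (π.1 *ᵥ x + π.2, π.1 *ᵥ x' + π.2)) fun π π' => by
        simp only [Prod.fst_add, Prod.snd_add, add_mulVec, Prod.mk_add_mk, Prod.mk.injEq]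
        constructor <;> abel
    have hφ : Function.Surjective φ := fun ⟨z, z'⟩ => by
      obtain ⟨l, hl⟩ := Function.ne_iff.1 hx
      let A : Matrix τ σ F := vecMulVec (z - z') (Pi.single l (x l - x' l)⁻¹)
      have hA : A *ᵥ x - A *ᵥ x' = z - z' := by
        rw [← mulVec_sub]
        ext i
        simp [A, vecMulVec_mulVec, single_dotProduct, ← mul_sub,
          inv_mul_cancel₀ (sub_ne_zero.2 hl)]
      refine ⟨(A, z - A *ᵥ x), Prod.ext ?_ ?_⟩
      · simp [φ]
      · change A *ᵥ x' + (z - A *ᵥ x) = z'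
        rw [← sub_sub_cancel z z', ← hA]
        abel
    have := card_fiber_mul_card_of_surjective φ hφ (y, y')
    rw [Fintype.card_prod, ← sq] at this
    simpa only [φ, AddMonoidHom.mk'_apply, Prod.mk.injEq] using this

end PairwiseUniform

section Independence

variable {K V κ : Type*} [DivisionRing K] [AddCommGroup V] [Module K V] [Finite κ]

theorem exists_finset_linearIndepOn_span_eq (v : κ → V) :
    ∃ I : Finset κ, #I = (Set.range v).finrank K ∧ LinearIndepOn K v I ∧
      Submodule.span K (v '' I) = Submodule.span K (Set.range v) := by
  have := Fintype.ofFinite κ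
  obtain ⟨ι, a, ha, hspan, hli⟩ := exists_linearIndependent' K v
  have := Fintype.ofInjective a ha
  refine ⟨univ.map ⟨a, ha⟩, ?_, ?_, ?_⟩
  · rw [card_map, card_univ, Set.finrank, ← hspan, finrank_span_eq_card hli]
  · rw [coe_map, coe_univ, Set.image_univ]
    exact (linearIndepOn_range_iff ha v).2 hli
  · rw [coe_map, coe_univ, Set.image_univ, ← hspan, Set.range_comp]
    rfl

end Independence

section Codes

variable {F X Y : Type*} [Field F]

/-- Evaluation at the point `x`, as a linear functional on the code (linear space of functions) `C`.
A linear relation between evaluation functionals is a relation satisfied by all codewords. -/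
def evalDual (C : Submodule F (X → F)) (x : X) : Dual F C :=
  LinearMap.proj x ∘ₗ C.subtype

theorem span_range_evalDual [Finite X] (C : Submodule F (X → F)) :
    Submodule.span F (Set.range (evalDual C)) = ⊤ := by
  refine Submodule.span_eq_top_of_ne_zero fun f hf => ?_
  obtain ⟨x, hx⟩ := Function.ne_iff.1 (Subtype.coe_ne_coe.2 hf)
  exact ⟨evalDual C x, ⟨x, rfl⟩, hx⟩

theorem exists_finset_linearIndepOn_evalDual [Finite X] (C : Submodule F (X → F)) :
    ∃ I : Finset X, #I = finrank F C ∧ LinearIndepOn F (evalDual C) I := by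
  obtain ⟨I, hI, hli, -⟩ := exists_finset_linearIndepOn_span_eq (K := F) (evalDual C)
  rw [Set.finrank, span_range_evalDual, finrank_top, Subspace.dual_finrank_eq] at hI
  exact ⟨I, hI, hli⟩

theorem linearIndependent_evalDual_of_comp {κ : Type*} {C : Submodule F (X → F)}
    {C' : Submodule F (Y → F)} {φ : X → Y} (hφ : ∀ g ∈ C', g ∘ φ ∈ C) {b : κ → X}
    (hb : LinearIndependent F fun k => evalDual C' (φ (b k))) :
    LinearIndependent F fun k => evalDual C (b k) :=
  hb.of_comp (((LinearMap.funLeft F F φ).restrict hφ).dualMap)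

theorem ncard_evalDual_mem_lt {ι : Type*} [Fintype ι] [Nonempty ι] [Finite X] [Fintype Y]
    [DecidableEq Y] {C : Submodule F (X → F)} {C' : Submodule F (Y → F)} {h : ι → X → Y}
    (hh : IsPairwiseUniform h) (hC : ∀ i, ∀ g ∈ C', g ∘ h i ∈ C) {W : Submodule F (Dual F C)}
    (hW : 2 * finrank F W < finrank F C') :
    {x | evalDual C x ∈ W}.ncard < Fintype.card Y := by
  have := Fintype.ofFinite X
  classical
  by_contra! hcard
  rw [Set.ncard_eq_toFinset_card'] at hcard
  obtain ⟨S, hSW, hS⟩ := exists_subset_card_eq hcard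
  obtain ⟨I, hI, hli⟩ := exists_finset_linearIndepOn_evalDual C'
  obtain ⟨i, hi⟩ := hh.exists_card_le_two_mul_card_hit hS I
  set J := {y ∈ I | ∃ s ∈ S, h i s = y}
  choose s hsS hsJ using fun y : J => (mem_filter.1 y.2).2
  have hmem (y : J) : evalDual C (s y) ∈ W := (Set.mem_toFinset.1 (hSW (hsS y)) :)
  have hind : LinearIndependent F fun y : J => evalDual C (s y) := by
    refine linearIndependent_evalDual_of_comp (hC i) ?_
    simp only [hsJ]
    exact hli.mono (coe_subset.2 (filter_subset _ I))
  have hindW : LinearIndependent F fun y : J => (⟨evalDual C (s y), hmem y⟩ : W) :=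
    hind.of_comp W.subtype
  have := hindW.fintype_card_le_finrank
  rw [Fintype.card_coe] at this
  omega

end Codes

section Tuples

variable {F V X κ : Type*} [Field F] [AddCommGroup V] [Module F V] [Fintype X] [Fintype κ]

theorem card_relations_mul [Fintype F] [DecidableEq κ] [DecidableEq V] (v : κ → V) :
    #{a : κ → F | ∑ k, a k • v k = 0} * Fintype.card F ^ (Set.range v).finrank F =
      Fintype.card F ^ Fintype.card κ := by
  have hker : #{a : κ → F | ∑ k, a k • v k = 0} =
      Nat.card (LinearMap.ker (Fintype.linearCombination F v)) := by
    rw [← Fintype.card_subtype, ← Nat.card_eq_fintype_card]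
    rfl
  rw [hker, natCard_eq_pow_finrank (K := F), Nat.card_eq_fintype_card, Set.finrank,
    ← Fintype.range_linearCombination, ← pow_add, add_comm,
    LinearMap.finrank_range_add_finrank_ker, finrank_fintype_fun_eq_card]

theorem ncard_pi_dependent_le (I : Finset κ) {P : (I → X) → Set X} {B : ℕ}
    (hP : ∀ c, (P c).ncard ≤ B) :
    {b : κ → X | ∀ k ∉ I, b k ∈ P fun i => b i}.ncard ≤
      Fintype.card X ^ #I * B ^ (Fintype.card κ - #I) := by
  classical
  let restr (b : {b : κ → X | ∀ k ∉ I, b k ∈ P fun i => b i}) :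
      Σ c : I → X, {k // k ∉ I} → P c := ⟨fun i => b.1 i, fun k => ⟨b.1 k, b.2 k k.2⟩⟩
  have hrestr : Function.Injective restr := fun b b' h => by
    have hI := congrArg Sigma.fst h
    have hIc := congrArg (fun s : Σ c, {k // k ∉ I} → P c => fun k => (s.2 k : X)) h
    ext k
    by_cases hk : k ∈ I
    · exact congrFun hI ⟨k, hk⟩
    · exact congrFun hIc ⟨k, hk⟩
  refine (Nat.card_le_card_of_injective restr hrestr).trans ?_
  rw [Nat.card_sigma]
  refine (sum_le_card_nsmul _ _ (B ^ (Fintype.card κ - #I)) fun c _ => ?_).trans_eq ?_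
  · rw [Nat.card_fun, Nat.card_coe_set_eq, Nat.card_eq_fintype_card, Fintype.card_subtype_compl,
      Fintype.card_coe]
    exact Nat.pow_le_pow_left (hP c) _
  · simp

theorem ncard_pi_finrank_lt_le {v : X → V} {R B : ℕ} (hR : R ≤ Fintype.card κ)
    (hBX : B ≤ Fintype.card X)
    (hB : ∀ W : Submodule F V, finrank F W < R → {x | v x ∈ W}.ncard ≤ B) :
    {b : κ → X | (Set.range (v ∘ b)).finrank F < R}.ncard ≤
      #{I : Finset κ | #I < R} * (Fintype.card X ^ R * B ^ (Fintype.card κ - R)) := by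
  let P (I : Finset κ) (c : I → X) : Set X := {x | v x ∈ Submodule.span F (Set.range (v ∘ c))}
  have hcover : {b : κ → X | (Set.range (v ∘ b)).finrank F < R} ⊆
      ⋃ I ∈ ({I | #I < R} : Finset (Finset κ)), {b | ∀ k ∉ I, b k ∈ P I fun i => b i} := by
    intro b hb
    obtain ⟨I, hI, -, hspan⟩ := exists_finset_linearIndepOn_span_eq (K := F) (v ∘ b)
    refine Set.mem_biUnion (x := I) (by simpa [hI] using hb) fun k _ => ?_
    have hk : v (b k) ∈ Submodule.span F (Set.range (v ∘ b)) := Submodule.subset_span ⟨k, rfl⟩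
    rw [← hspan, Set.image_eq_range] at hk
    exact hk
  refine (Set.ncard_le_ncard hcover (Set.toFinite _)).trans <|
    (Finset.set_ncard_biUnion_le _ _).trans <| sum_le_card_nsmul _ _ _ fun I hI => ?_
  have hIR : #I < R := (mem_filter.1 hI).2
  have hP (c : I → X) : (P I c).ncard ≤ B :=
    hB _ <| ((finrank_range_le_card (R := F) (v ∘ c)).trans_eq (Fintype.card_coe I)).trans_lt hIR
  refine (ncard_pi_dependent_le I hP).trans ?_
  calc Fintype.card X ^ #I * B ^ (Fintype.card κ - #I)
      = Fintype.card X ^ #I * B ^ (R - #I) * B ^ (Fintype.card κ - R) := by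
        rw [mul_assoc, ← pow_add]; congr 2; omega
    _ ≤ Fintype.card X ^ #I * Fintype.card X ^ (R - #I) * B ^ (Fintype.card κ - R) := by gcongr
    _ = Fintype.card X ^ R * B ^ (Fintype.card κ - R) := by
        rw [← pow_add, Nat.add_sub_of_le hIR.le]

theorem card_filter_card_lt_le {R : ℕ} (hκ : Fintype.card κ = 8 * R) :
    #{I : Finset κ | #I < R} ≤ 32 ^ R := by
  have hterm (I : Finset κ) (hI : I ∈ ({I | #I < R} : Finset (Finset κ))) :
      8 ^ (7 * R) ≤ 1 ^ #I * 8 ^ (Fintype.card κ - #I) := by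
    have := (mem_filter.1 hI).2
    rw [one_pow, one_mul]
    exact Nat.pow_le_pow_right (by norm_num) (by omega)
  have hsum : #{I : Finset κ | #I < R} * 8 ^ (7 * R) ≤ 9 ^ (8 * R) := calc
    _ ≤ ∑ I ∈ ({I | #I < R} : Finset (Finset κ)), 1 ^ #I * 8 ^ (Fintype.card κ - #I) := by
      simpa using card_nsmul_le_sum _ _ _ hterm
    _ ≤ ∑ I : Finset κ, 1 ^ #I * 8 ^ (Fintype.card κ - #I) :=
      sum_le_univ_sum_of_nonneg fun _ => Nat.zero_le _
    _ = 9 ^ (8 * R) := by rw [Fintype.sum_pow_mul_eq_add_pow, hκ]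
  have hnum : 9 ^ (8 * R) ≤ 32 ^ R * 8 ^ (7 * R) := by
    rw [pow_mul, pow_mul, ← mul_pow]
    exact Nat.pow_le_pow_left (by norm_num) R
  exact Nat.le_of_mul_le_mul_right (hsum.trans hnum) (by positivity)

theorem two_mul_ncard_pi_finrank_lt_mul_le [Fintype F] {v : X → V} {m R B : ℕ} (hm : m ≠ 0)
    (hR : R ≠ 0) (hκ : Fintype.card κ = 8 * R) (hX : Fintype.card X = Fintype.card F ^ m * B)
    (hB : ∀ W : Submodule F V, finrank F W < R → {x | v x ∈ W}.ncard ≤ B) :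
    2 * ({b : κ → X | (Set.range (v ∘ b)).finrank F < R}.ncard * Fintype.card F ^ (m * R)) ≤
      Fintype.card X ^ (8 * R) := by
  set q := Fintype.card F
  have hq : 2 ≤ q := Fintype.one_lt_card
  have hBX : B ≤ Fintype.card X := hX ▸ Nat.le_mul_of_pos_left B (by positivity)
  have hlow := ncard_pi_finrank_lt_le (κ := κ) (by omega) hBX hB
  have hpow : 2 * 32 ^ R ≤ q ^ (6 * (m * R)) := calc
    2 * 32 ^ R ≤ 2 ^ R * 32 ^ R := by gcongr; exact Nat.le_self_pow hR 2
    _ = 2 ^ (6 * R) := by rw [← mul_pow, pow_mul]; rfl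
    _ ≤ q ^ (6 * R) := Nat.pow_le_pow_left hq _
    _ ≤ q ^ (6 * (m * R)) := by
      gcongr
      · omega
      · exact Nat.le_mul_of_pos_left R (Nat.pos_of_ne_zero hm)
  have hexp : 8 * R - R = 7 * R := by omega
  rw [hκ, hexp] at hlow
  calc _ ≤ 2 * (32 ^ R * (Fintype.card X ^ R * B ^ (7 * R)) * q ^ (m * R)) := by
        gcongr
        exact hlow.trans (by gcongr; exact card_filter_card_lt_le hκ)
    _ = 2 * 32 ^ R * (Fintype.card X ^ R * B ^ (7 * R) * q ^ (m * R)) := by ring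
    _ ≤ q ^ (6 * (m * R)) * (Fintype.card X ^ R * B ^ (7 * R) * q ^ (m * R)) := by gcongr
    _ = Fintype.card X ^ R * (q ^ m * B) ^ (7 * R) := by ring
    _ = Fintype.card X ^ (8 * R) := by rw [← hX, ← pow_add]; congr 1; omega

section Bilinear

variable {α : Type*} [Fintype F] [Fintype α] [DecidableEq α] [DecidableEq κ] [DecidableEq V]

theorem card_bilinear_relations_eq (v : X → V) :
    #{q : (α → κ → F) × (κ → X) | ∀ i, ∑ k, q.1 i k • v (q.2 k) = 0} =
      ∑ b : κ → X, #{a : κ → F | ∑ k, a k • v (b k) = 0} ^ Fintype.card α := by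
  rw [card_filter, Fintype.sum_prod_type_right]
  refine sum_congr rfl fun b _ => ?_
  rw [← card_filter, ← card_univ, ← prod_const, ← Fintype.card_piFinset]
  congr 1
  ext a
  simp

theorem card_bilinear_relations_mul_le (v : X → V) (R : ℕ) :
    #{q : (α → κ → F) × (κ → X) | ∀ i, ∑ k, q.1 i k • v (q.2 k) = 0} *
        Fintype.card F ^ (Fintype.card α * R) ≤
      (Fintype.card X ^ Fintype.card κ + {b : κ → X | (Set.range (v ∘ b)).finrank F < R}.ncard *
        Fintype.card F ^ (Fintype.card α * R)) *
          Fintype.card F ^ (Fintype.card α * Fintype.card κ) := by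
  set q := Fintype.card F
  set m := Fintype.card α
  have hq : 0 < q := Fintype.card_pos
  have hpt (b : κ → X) : #{a : κ → F | ∑ k, a k • v (b k) = 0} ^ m * q ^ (m * R) ≤
      (1 + (if (Set.range (v ∘ b)).finrank F < R then 1 else 0) * q ^ (m * R)) *
        q ^ (m * Fintype.card κ) := by
    rw [mul_comm m, mul_comm m, pow_mul, pow_mul, ← mul_pow]
    have hrel := card_relations_mul (F := F) (v ∘ b)
    simp only [Function.comp_apply] at hrel
    split_ifs with hlow
    · rw [one_mul, mul_pow, add_mul, one_mul, mul_comm]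
      refine le_add_left (Nat.mul_le_mul_left _ (Nat.pow_le_pow_left ?_ m))
      exact hrel ▸ Nat.le_mul_of_pos_right _ (by positivity)
    · rw [zero_mul, add_zero, one_mul, ← hrel]
      exact Nat.pow_le_pow_left (Nat.mul_le_mul_left _ (Nat.pow_le_pow_right hq (not_lt.1 hlow))) m
  rw [card_bilinear_relations_eq, sum_mul]
  refine (sum_le_sum fun b _ => hpt b).trans_eq ?_
  rw [← sum_mul, sum_add_distrib, ← sum_mul, ← card_filter, sum_const, card_univ,
    Fintype.card_fun, smul_eq_mul, mul_one, Set.ncard_eq_toFinset_card', Set.toFinset_ofPred]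

theorem two_mul_card_bilinear_relations_mul_le [Nonempty α] {v : X → V} {R B : ℕ} (hR : R ≠ 0)
    (hκ : Fintype.card κ = 8 * R)
    (hX : Fintype.card X = Fintype.card F ^ Fintype.card α * B)
    (hB : ∀ W : Submodule F V, finrank F W < R → {x | v x ∈ W}.ncard ≤ B) :
    2 * (#{q : (α → κ → F) × (κ → X) | ∀ i, ∑ k, q.1 i k • v (q.2 k) = 0} *
        Fintype.card F ^ (Fintype.card α * R)) ≤
      3 * (Fintype.card X * Fintype.card F ^ Fintype.card α) ^ (8 * R) := by
  have hlow := two_mul_ncard_pi_finrank_lt_mul_le Fintype.card_ne_zero hR hκ hX hB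
  have hrel := card_bilinear_relations_mul_le (F := F) (α := α) (κ := κ) v R
  rw [hκ, pow_mul _ _ (8 * R)] at hrel
  rw [mul_pow]
  refine (Nat.mul_le_mul_left 2 hrel).trans ?_
  rw [← mul_assoc, ← mul_assoc]
  exact Nat.mul_le_mul_right _ (by omega)

end Bilinear

end Tuples

section Moments

theorem addChar_map_sum {A M κ : Type*} [AddCommMonoid A] [CommMonoid M] (ψ : AddChar A M)
    (s : Finset κ) (a : κ → A) : ψ (∑ k ∈ s, a k) = ∏ k ∈ s, ψ (a k) :=
  map_prod ψ.toMonoidHom (fun k => Multiplicative.ofAdd (a k)) s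

theorem sum_addChar_dual {F V R : Type*} [Field F] [AddCommGroup V] [Module F V] [Fintype V]
    [CommRing R] [IsDomain R] [DecidableEq (Dual F V)] {ψ : AddChar F R} (hψ : ψ ≠ 1)
    (L : Dual F V) : ∑ f, ψ (L f) = if L = 0 then (Fintype.card V : R) else 0 := by
  split_ifs with hL
  · simp [hL]
  · refine AddChar.sum_eq_zero_of_ne_one (ψ := ψ.compAddMonoidHom L.toAddMonoidHom) fun h => hψ ?_
    ext a
    obtain ⟨f, rfl⟩ := LinearMap.surjective hL a
    exact DFunLike.congr_fun h f

theorem ofReal_norm_sum_pow_eq {F X : Type*} [Ring F] [Finite F] [Fintype X] (ψ : AddChar F ℂ)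
    (t : ℕ) (g : X → F) :
    ((‖∑ x, ψ (g x)‖ ^ (2 * t) : ℝ) : ℂ) =
      ∑ b : Fin t ⊕ Fin t → X, ψ (∑ k, (Sum.elim 1 (-1) k : F) * g (b k)) := by
  simp_rw [addChar_map_sum]
  rw [← Fintype.prod_sum fun k (x : X) => ψ ((Sum.elim 1 (-1) k : F) * g x),
    Fintype.prod_sum_type]
  simp only [Sum.elim_inl, Sum.elim_inr, Pi.one_apply, Pi.neg_apply, one_mul, neg_mul, prod_const,
    card_univ, Fintype.card_fin, AddChar.map_neg_eq_conj]
  rw [← map_sum (starRingEnd ℂ), ← mul_pow, Complex.mul_conj', pow_mul]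
  push_cast
  rfl

theorem sum_norm_sum_pow_eq {F X : Type*} [Field F] [Finite F] [Fintype X] {ψ : AddChar F ℂ}
    (hψ : ψ ≠ 1) (C : Submodule F (X → F)) [Fintype C] [DecidableEq (Dual F C)] (t : ℕ) :
    ∑ f : C, ‖∑ x, ψ (f.1 x)‖ ^ (2 * t) = (Fintype.card C : ℝ) *
      #{b : Fin t ⊕ Fin t → X | ∑ k, (Sum.elim 1 (-1) k : F) • evalDual C (b k) = 0} := by
  have hexpand (f : C) : ((‖∑ x, ψ (f.1 x)‖ ^ (2 * t) : ℝ) : ℂ) =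
      ∑ b : Fin t ⊕ Fin t → X, ψ ((∑ k, (Sum.elim 1 (-1) k : F) • evalDual C (b k)) f) := by
    rw [ofReal_norm_sum_pow_eq]
    simp [evalDual]
  apply Complex.ofReal_injective
  rw [Complex.ofReal_sum, sum_congr rfl fun f _ => hexpand f, sum_comm]
  simp_rw [sum_addChar_dual hψ]
  rw [← sum_filter, sum_const, nsmul_eq_mul, mul_comm]
  norm_cast

end Moments

section Markov

theorem unifProb_gt_mul_pow_le {α : Type*} (S : Set α) [Fintype S] (g : α → ℝ) (hg : ∀ a, 0 ≤ g a)
    {τ : ℝ} (hτ : 0 ≤ τ) (k : ℕ) :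
    unifProb S (fun a => g a > τ) * τ ^ k ≤ (∑ a : S, g a ^ k) / Fintype.card S := by
  let E : Finset S := {a | g a > τ}
  have hcard : {a | a ∈ S ∧ g a > τ}.ncard = #E := by
    rw [← Set.ncard_coe_finset, ← Set.ncard_image_of_injective _ Subtype.val_injective]
    congr 1
    ext a
    simp [E, and_comm]
  rw [unifProb, hcard, Set.ncard_eq_toFinset_card', Set.toFinset_card, div_mul_eq_mul_div]
  gcongr
  calc #E * τ ^ k = ∑ _a ∈ E, τ ^ k := by rw [sum_const, nsmul_eq_mul]
    _ ≤ ∑ a ∈ E, g a ^ k :=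
      sum_le_sum fun a ha => pow_le_pow_left₀ hτ (mem_filter.1 ha).2.le k
    _ ≤ ∑ a : S, g a ^ k := sum_le_univ_sum_of_nonneg fun a => pow_nonneg (hg a) k

end Markov

section ReedMuller

open MvPolynomial Matrix

theorem totalDegree_bind₁_le {R σ τ : Type*} [CommSemiring R] {f : σ → MvPolynomial τ R} {k : ℕ}
    (hf : ∀ i, (f i).totalDegree ≤ k) (P : MvPolynomial σ R) :
    (bind₁ f P).totalDegree ≤ P.totalDegree * k := by
  rw [← aeval_eq_bind₁, aeval_def, eval₂_eq]
  refine (totalDegree_finsetSum _ _).trans (Finset.sup_le fun e he => ?_)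
  calc (algebraMap R (MvPolynomial τ R) (P.coeff e) * ∏ i ∈ e.support, f i ^ e i).totalDegree
      ≤ 0 + ∑ i ∈ e.support, e i * k := by
        refine (totalDegree_mul _ _).trans (add_le_add (totalDegree_C _).le ?_)
        refine (totalDegree_finsetProd _ _).trans (sum_le_sum fun i _ => ?_)
        exact (totalDegree_pow _ _).trans (Nat.mul_le_mul_left _ (hf i))
    _ = (e.sum fun _ a => a) * k := by rw [zero_add, ← sum_mul]; rfl
    _ ≤ P.totalDegree * k := Nat.mul_le_mul_right _ (le_totalDegree he)

/-- The generalized Reed–Muller code of order `D`: the functions on `F ^ σ` that are given by a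
polynomial of total degree at most `D`. -/
noncomputable def reedMuller (F σ : Type*) [Field F] (D : ℕ) : Submodule F ((σ → F) → F) :=
  (restrictTotalDegree σ F D).map (evalₗ F σ)

variable {F σ τ : Type*} [Field F] {D E : ℕ}

theorem mem_reedMuller {g : (σ → F) → F} :
    g ∈ reedMuller F σ D ↔ ∃ P : MvPolynomial σ F, P.totalDegree ≤ D ∧ ∀ x, eval x P = g x := by
  simp [reedMuller, mem_restrictTotalDegree, funext_iff]

theorem const_mem_reedMuller (c : F) : (fun _ => c) ∈ reedMuller F σ D :=
  mem_reedMuller.2 ⟨C c, by simp, by simp⟩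

theorem coord_mem_reedMuller (i : σ) : (fun x => x i) ∈ reedMuller F σ 1 :=
  mem_reedMuller.2 ⟨X i, by simp, by simp⟩

theorem mul_mem_reedMuller {g g' : (σ → F) → F} (hg : g ∈ reedMuller F σ D)
    (hg' : g' ∈ reedMuller F σ E) : g * g' ∈ reedMuller F σ (D + E) := by
  obtain ⟨P, hP, hPg⟩ := mem_reedMuller.1 hg
  obtain ⟨P', hP', hPg'⟩ := mem_reedMuller.1 hg'
  refine mem_reedMuller.2 ⟨P * P', (totalDegree_mul _ _).trans (add_le_add hP hP'), fun x => ?_⟩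
  rw [eval_mul, hPg, hPg', Pi.mul_apply]

theorem comp_mem_reedMuller {g : (σ → F) → F} (hg : g ∈ reedMuller F σ D)
    {φ : (τ → F) → σ → F} (hφ : ∀ i, (fun x => φ x i) ∈ reedMuller F τ 1) :
    g ∘ φ ∈ reedMuller F τ D := by
  obtain ⟨P, hP, hPg⟩ := mem_reedMuller.1 hg
  choose f hf hfφ using fun i => mem_reedMuller.1 (hφ i)
  refine mem_reedMuller.2 ⟨bind₁ f P, (totalDegree_bind₁_le hf P).trans (by omega), fun x => ?_⟩
  rw [Function.comp_apply, ← hPg, ← coe_aeval_eq_eval, RingHom.coe_coe, aeval_bind₁,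
    aeval_eq_eval]
  congr 2
  exact funext fun i => hfφ i x

theorem comp_affine_mem_reedMuller [Fintype τ] {g : (σ → F) → F} (hg : g ∈ reedMuller F σ D)
    (A : Matrix σ τ F) (c : σ → F) : (g ∘ fun x => A *ᵥ x + c) ∈ reedMuller F τ D := by
  refine comp_mem_reedMuller hg fun i => ?_
  have hsum : ∑ j, A i j • (fun x : τ → F => x j) ∈ reedMuller F τ 1 :=
    Submodule.sum_mem _ fun j _ => Submodule.smul_mem _ _ (coord_mem_reedMuller j)
  convert! Submodule.add_mem _ hsum (const_mem_reedMuller (c i)) using 1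
  ext x
  simp [mulVec, dotProduct]

theorem coord_mul_comp_mem_reedMuller {g : (τ → F) → F} (hg : g ∈ reedMuller F τ D) (i : σ)
    (e : τ → σ) : (fun x => x i * g (x ∘ e)) ∈ reedMuller F σ (D + 1) :=
  add_comm 1 D ▸ mul_mem_reedMuller (coord_mem_reedMuller i)
    (comp_mem_reedMuller hg fun j => coord_mem_reedMuller (e j))

theorem sum_smul_evalDual_eq_zero_iff {X κ : Type*} [Fintype κ] {C : Submodule F (X → F)}
    {s : κ → F} {b : κ → X} :
    ∑ k, s k • evalDual C (b k) = 0 ↔ ∀ g ∈ C, ∑ k, s k * g (b k) = 0 := by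
  simp [LinearMap.ext_iff, evalDual]

/-- Testing a relation on the products of a variable with a polynomial in the other variables turns
the annihilated tuples into zeros of a system of bilinear equations. -/
theorem card_annihilated_le_card_bilinear_relations {α β κ : Type*} [Fintype α] [Fintype β]
    [Fintype σ] [Fintype κ] [DecidableEq α] [DecidableEq κ] [Fintype F]
    [DecidableEq (Dual F (reedMuller F σ (D + 1)))]
    [DecidableEq (Dual F (reedMuller F β D))] [DecidableEq σ] [DecidableEq β]
    (e : α ⊕ β ≃ σ) {s : κ → F} (hs : ∀ k, s k ≠ 0) :
    #{b : κ → σ → F | ∑ k, s k • evalDual (reedMuller F σ (D + 1)) (b k) = 0} ≤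
      #{q : (α → κ → F) × (κ → β → F) |
        ∀ i, ∑ k, q.1 i k • evalDual (reedMuller F β D) (q.2 k) = 0} := by
  refine card_le_card_of_injOn
    (fun b => (fun i k => s k * b k (e (.inl i)), fun k => b k ∘ e ∘ .inr)) ?_ ?_
  · intro b hb
    simp only [coe_filter, mem_univ, true_and, Set.mem_ofPred_eq,
      sum_smul_evalDual_eq_zero_iff] at hb ⊢
    intro i g hg
    simpa only [mul_assoc] using hb _ (coord_mul_comp_mem_reedMuller hg (e (.inl i)) (e ∘ .inr))
  · intro b _ b' _ h
    ext k l
    obtain ⟨i | j, rfl⟩ := e.surjective l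
    · exact mul_left_cancel₀ (hs k) (congrFun (congrFun (congrArg Prod.fst h) i) k)
    · exact congrFun (congrFun (congrArg Prod.snd h) k) j

end ReedMuller

section ReducedExponents

variable {σ : Type*} [Fintype σ] {q D : ℕ}

/-- The exponent vectors of the monomials of degree at most `D` in the variables `σ` in which every
variable has exponent less than `q`; `RMBias.monomials` is the case `σ = Fin n`. -/
noncomputable def reducedExponents (q : ℕ) (σ : Type*) [Fintype σ] (D : ℕ) : Finset (σ →₀ ℕ) :=
  {e ∈ univ.finsupp fun _ => range q | ∑ i, e i ≤ D}

theorem mem_reducedExponents {e : σ →₀ ℕ} :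
    e ∈ reducedExponents q σ D ↔ (∀ i, e i < q) ∧ ∑ i, e i ≤ D := by
  simp [reducedExponents, mem_finsupp_iff]

theorem coe_reducedExponents_fin (p d n : ℕ) : (reducedExponents p (Fin n) d : Set _) =
    monomials p d n :=
  Set.ext fun _ => mem_reducedExponents

section Reduction

open MvPolynomial

variable {F : Type*} [Field F] [Fintype F]

theorem exists_lt_card_pow_eq (k : ℕ) :
    ∃ l < Fintype.card F, l ≤ k ∧ ∀ a : F, a ^ l = a ^ k := by
  induction k using Nat.strong_induction_on with
  | _ k ih =>
    obtain hk | hk := lt_or_ge k (Fintype.card F)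
    · exact ⟨k, hk, le_rfl, fun _ => rfl⟩
    · have hq : 1 < Fintype.card F := Fintype.one_lt_card
      obtain ⟨l, hl, hlk, hpow⟩ := ih (k - Fintype.card F + 1) (by omega)
      refine ⟨l, hl, hlk.trans (by omega), fun a => ?_⟩
      rw [hpow, pow_succ, ← congrArg (a ^ (k - Fintype.card F) * ·) (FiniteField.pow_card a),
        ← pow_add, Nat.sub_add_cancel hk]

theorem exists_mem_reducedExponents_eval_monomial {e : σ →₀ ℕ} (he : ∑ i, e i ≤ D) :
    ∃ e' ∈ reducedExponents (Fintype.card F) σ D,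
      evalₗ F σ (monomial e' 1) = evalₗ F σ (monomial e 1) := by
  choose l hl hle hpow using fun i => exists_lt_card_pow_eq (F := F) (e i)
  refine ⟨Finsupp.equivFunOnFinite.symm l, mem_reducedExponents.2
    ⟨hl, (sum_le_sum fun i _ => hle i).trans he⟩, funext fun x => ?_⟩
  simp [eval_monomial, Finsupp.prod_fintype, hpow]

theorem reedMuller_eq_map_restrictSupport : reedMuller F σ D =
    (restrictSupport F (reducedExponents (Fintype.card F) σ D)).map (evalₗ F σ) := by
  refine le_antisymm ?_ (Submodule.map_mono (restrictSupport_mono F fun e he => ?_))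
  · rw [reedMuller, restrictTotalDegree, restrictSupport_eq_span, Submodule.map_span_le]
    rintro _ ⟨e, he, rfl⟩
    rw [Set.mem_ofPred_eq, Finsupp.sum_fintype _ _ fun _ => rfl] at he
    obtain ⟨e', he', heval⟩ := exists_mem_reducedExponents_eval_monomial (F := F) he
    exact ⟨monomial e' 1, (monomial_mem_restrictSupport F).2 (.inl he'), heval⟩
  · rw [Set.mem_ofPred_eq, Finsupp.sum_fintype _ _ fun _ => rfl]
    exact (mem_reducedExponents.1 he).2

theorem injOn_evalₗ_restrictSupport : Set.InjOn (evalₗ F σ)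
    (restrictSupport F (reducedExponents (Fintype.card F) σ D : Set (σ →₀ ℕ))) := by
  refine LinearMap.injOn_of_disjoint_ker le_rfl <| Submodule.disjoint_def.2 fun P hP hker => ?_
  refine eq_zero_of_eval_zero_at_prod_finset P (fun _ => univ) (fun i => ?_) fun x _ =>
    congrFun (LinearMap.mem_ker.1 hker) x
  rw [card_univ, degreeOf_lt_iff Fintype.card_pos]
  exact fun e he => (mem_reducedExponents.1 (hP he)).1 i

theorem finrank_reedMuller :
    finrank F (reedMuller F σ D) = #(reducedExponents (Fintype.card F) σ D) := by
  rw [reedMuller_eq_map_restrictSupport, ← LinearMap.range_domRestrict,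
    LinearMap.finrank_range_of_inj (Set.injOn_iff_injective.1 injOn_evalₗ_restrictSupport),
    finrank_eq_card_basis (basisRestrictSupport F _)]
  simp

end Reduction

section Counting

theorem zero_mem_reducedExponents (hq : 0 < q) : 0 ∈ reducedExponents q σ D :=
  mem_reducedExponents.2 ⟨fun _ => hq, by simp⟩

theorem card_mul_sum_exponent_le (i : σ) :
    Fintype.card σ * ∑ e ∈ reducedExponents q σ D, e i ≤ #(reducedExponents q σ D) * D := by
  classical
  have hsymm (j : σ) : ∑ e ∈ reducedExponents q σ D, e j = ∑ e ∈ reducedExponents q σ D, e i := by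
    refine sum_equiv (Finsupp.domCongr (Equiv.swap i j)).toEquiv (fun e => ?_) fun e _ => ?_
    · simp only [mem_reducedExponents]
      refine and_congr ⟨fun h l => h _, fun h l => ?_⟩ (by
        simp [Equiv.sum_comp (Equiv.swap i j) e])
      simpa using h (Equiv.swap i j l)
    · simp
  calc Fintype.card σ * ∑ e ∈ reducedExponents q σ D, e i
      = ∑ j, ∑ e ∈ reducedExponents q σ D, e j := by simp [hsymm]
    _ = ∑ e ∈ reducedExponents q σ D, ∑ j, e j := sum_comm
    _ ≤ #(reducedExponents q σ D) * D :=
        sum_le_card_nsmul _ _ _ fun e he => (mem_reducedExponents.1 he).2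

theorem card_reducedExponents_le_add {α β : Type*} [Fintype α] [Fintype β] (φ : α ⊕ β ≃ σ) :
    Fintype.card σ * #(reducedExponents q σ D) ≤
      Fintype.card σ * #(reducedExponents q β D) +
        Fintype.card α * D * #(reducedExponents q σ D) := by
  set M := reducedExponents q σ D
  have hpt (e : σ →₀ ℕ) : 1 ≤ (if ∀ i, e (φ (.inl i)) = 0 then 1 else 0) +
      ∑ i, e (φ (.inl i)) := by
    split_ifs with h
    · omega
    · obtain ⟨i, hi⟩ := not_forall.1 h
      have := single_le_sum (f := fun i => e (φ (.inl i))) (fun _ _ => Nat.zero_le _) (mem_univ i)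
      omega
  have hcard : #{e ∈ M | ∀ i, e (φ (.inl i)) = 0} ≤ #(reducedExponents q β D) := by
    refine card_le_card_of_injOn (fun e => Finsupp.equivFunOnFinite.symm (e ∘ φ ∘ .inr)) ?_ ?_
    · intro e he
      obtain ⟨hlt, hdeg⟩ := mem_reducedExponents.1 (mem_filter.1 he).1
      rw [← φ.sum_comp, Fintype.sum_sum_type] at hdeg
      exact mem_reducedExponents.2 ⟨fun i => hlt _, le_of_add_le_right hdeg⟩
    · intro e he e' he' h
      ext l
      obtain ⟨i | j, rfl⟩ := φ.surjective l
      · rw [(mem_filter.1 he).2, (mem_filter.1 he').2]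
      · exact DFunLike.congr_fun h j
  have hsum : #M ≤ #{e ∈ M | ∀ i, e (φ (.inl i)) = 0} + ∑ i, ∑ e ∈ M, e (φ (.inl i)) := by
    rw [card_eq_sum_ones, card_filter, sum_comm, ← sum_add_distrib]
    exact sum_le_sum fun e _ => hpt e
  calc Fintype.card σ * #M
      ≤ Fintype.card σ * #(reducedExponents q β D) +
          ∑ i : α, Fintype.card σ * ∑ e ∈ M, e (φ (.inl i)) := by
        rw [← mul_sum, ← mul_add]
        gcongr
        exact hsum.trans (by gcongr)
    _ ≤ Fintype.card σ * #(reducedExponents q β D) + Fintype.card α * (#M * D) := by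
        gcongr
        exact sum_le_card_nsmul _ _ _ fun i _ => card_mul_sum_exponent_le _
    _ = _ := by ring

theorem one_sub_mul_card_reducedExponents_le {α β : Type*} [Fintype α] [Fintype β] [Nonempty σ]
    (φ : α ⊕ β ≃ σ) {ρ : ℝ} (hρ : Fintype.card α * D ≤ ρ * Fintype.card σ) :
    (1 - ρ) * #(reducedExponents q σ D) ≤ #(reducedExponents q β D) := by
  have hσ : (0 : ℝ) < Fintype.card σ := Nat.cast_pos.2 Fintype.card_pos
  have hadd : (Fintype.card σ * #(reducedExponents q σ D) : ℝ) ≤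
      Fintype.card σ * #(reducedExponents q β D) +
        Fintype.card α * D * #(reducedExponents q σ D) := by
    exact_mod_cast card_reducedExponents_le_add φ
  have hmul := mul_le_mul_of_nonneg_right hρ (Nat.cast_nonneg (α := ℝ) #(reducedExponents q σ D))
  refine le_of_mul_le_mul_left ?_ hσ
  linarith

theorem sum_exponent_succ_le (i : σ) : ∑ e ∈ reducedExponents q σ (D + 1), e i ≤
    ∑ e ∈ reducedExponents q σ D, (e i + 1) := by
  classical
  calc ∑ e ∈ reducedExponents q σ (D + 1), e i
      ≤ ∑ e ∈ (reducedExponents q σ D).map (addRightEmbedding (Finsupp.single i 1)), e i := by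
        refine sum_le_sum_of_ne_zero fun e he hei => ?_
        obtain ⟨e', rfl⟩ := exists_add_of_le
          (Finsupp.single_le_iff.2 (Nat.one_le_iff_ne_zero.2 hei))
        obtain ⟨hlt, hdeg⟩ := mem_reducedExponents.1 he
        refine mem_map.2 ⟨e', mem_reducedExponents.2 ⟨fun l => ?_, ?_⟩, add_comm _ _⟩
        · exact (Nat.le_add_left _ _).trans_lt (hlt l)
        · simp only [Finsupp.add_apply, sum_add_distrib, Finsupp.univ_sum_single_apply] at hdeg
          omega
    _ = ∑ e ∈ reducedExponents q σ D, (e i + 1) := by simp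

theorem succ_mul_card_reducedExponents_le :
    (D + 1) * #(reducedExponents q σ (D + 1)) ≤
      (Fintype.card σ + 2 * (D + 1)) * #(reducedExponents q σ D) := by
  have hpt (e : σ →₀ ℕ) : D + 1 ≤ (D + 1) * (if ∑ i, e i ≤ D then 1 else 0) + ∑ i, e i := by
    split_ifs <;> omega
  have hfilter : {e ∈ reducedExponents q σ (D + 1) | ∑ i, e i ≤ D} = reducedExponents q σ D := by
    ext e
    simp only [mem_filter, mem_reducedExponents]
    exact ⟨fun h => ⟨h.1.1, h.2⟩, fun h => ⟨⟨h.1, Nat.le_succ_of_le h.2⟩, h.2⟩⟩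
  have hdeg : ∑ i, ∑ e ∈ reducedExponents q σ (D + 1), e i ≤
      #(reducedExponents q σ D) * (D + Fintype.card σ) := calc
    _ ≤ ∑ i, ∑ e ∈ reducedExponents q σ D, (e i + 1) := sum_le_sum fun i _ => sum_exponent_succ_le i
    _ = ∑ e ∈ reducedExponents q σ D, ∑ i, (e i + 1) := sum_comm
    _ ≤ _ := sum_le_card_nsmul _ _ _ fun e he => by
      simpa [sum_add_distrib] using (mem_reducedExponents.1 he).2
  have hsum := sum_le_sum fun e (_ : e ∈ reducedExponents q σ (D + 1)) => hpt e
  rw [sum_const, smul_eq_mul, sum_add_distrib, ← mul_sum, ← card_filter, hfilter, sum_comm] at hsum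
  nlinarith

end Counting
end ReducedExponents

section BiasBound

variable {F σ τ : Type*} [Field F] [Fintype F] [Fintype τ] {D : ℕ}

theorem ncard_evalDual_reedMuller_mem_lt [Finite σ]
    {W : Submodule F (Dual F (reedMuller F σ D))}
    (hW : 2 * finrank F W < finrank F (reedMuller F τ D)) :
    {x | evalDual (reedMuller F σ D) x ∈ W}.ncard < Fintype.card F ^ Fintype.card τ := by
  classical
  have := Fintype.ofFinite σ
  exact (ncard_evalDual_mem_lt isPairwiseUniform_affine
    (fun π g hg => comp_affine_mem_reedMuller hg π.1 π.2) hW).trans_eq Fintype.card_fun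

variable [Fintype σ] [DecidableEq σ]

theorem two_mul_card_annihilated_mul_le {α β κ : Type*} [Fintype α] [Nonempty α] [Fintype β]
    [Fintype κ] [DecidableEq κ] [DecidableEq (Dual F (reedMuller F σ (D + 1)))]
    (e : α ⊕ β ≃ σ) (hβ : Fintype.card β = Fintype.card α + Fintype.card τ) {s : κ → F}
    (hs : ∀ k, s k ≠ 0) {R : ℕ} (hR : R ≠ 0) (hκ : Fintype.card κ = 8 * R)
    (hRτ : 2 * (R - 1) < finrank F (reedMuller F τ D)) :
    2 * (#{b : κ → σ → F | ∑ k, s k • evalDual (reedMuller F σ (D + 1)) (b k) = 0} *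
        Fintype.card F ^ (Fintype.card α * R)) ≤
      3 * Fintype.card (σ → F) ^ (8 * R) := by
  classical
  have hX : Fintype.card (β → F) =
      Fintype.card F ^ Fintype.card α * Fintype.card F ^ Fintype.card τ := by
    rw [Fintype.card_fun, hβ, pow_add]
  have hσ : Fintype.card (β → F) * Fintype.card F ^ Fintype.card α = Fintype.card (σ → F) := by
    rw [Fintype.card_fun, Fintype.card_fun, ← pow_add, add_comm, ← Fintype.card_sum,
      Fintype.card_congr e]
  have hB (W : Submodule F (Dual F (reedMuller F β D))) (hW : finrank F W < R) :
      {x | evalDual (reedMuller F β D) x ∈ W}.ncard ≤ Fintype.card F ^ Fintype.card τ :=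
    (ncard_evalDual_reedMuller_mem_lt (by omega)).le
  rw [← hσ]
  refine le_trans ?_ (two_mul_card_bilinear_relations_mul_le hR hκ hX hB)
  gcongr
  exact card_annihilated_le_card_bilinear_relations e hs

open scoped BigOperators in
theorem unifProb_norm_expect_mul_le {α β : Type*} [Fintype α] [Nonempty α] [Fintype β]
    {ψ : AddChar F ℂ} (hψ : ψ ≠ 1) (e : α ⊕ β ≃ σ)
    (hβ : Fintype.card β = Fintype.card α + Fintype.card τ) {R : ℕ} (hR : R ≠ 0)
    (hRτ : 2 * (R - 1) < finrank F (reedMuller F τ D)) {ε : ℝ} (hε : 0 ≤ ε) :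
    unifProb (reedMuller F σ (D + 1) : Set ((σ → F) → F)) (fun f => ‖𝔼 x, ψ (f x)‖ > ε) *
      ε ^ (8 * R) * Fintype.card F ^ (Fintype.card α * R) ≤ 3 / 2 := by
  classical
  set C := reedMuller F σ (D + 1)
  set q := Fintype.card F
  set Z := Fintype.card (σ → F)
  have hcount := two_mul_card_annihilated_mul_le (D := D) (κ := Fin (4 * R) ⊕ Fin (4 * R)) e hβ
    (s := Sum.elim 1 (-1)) (by simp) hR (by rw [Fintype.card_sum, Fintype.card_fin]; omega) hRτ
  set N := #{b : Fin (4 * R) ⊕ Fin (4 * R) → σ → F |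
    ∑ k, (Sum.elim 1 (-1) k : F) • evalDual C (b k) = 0}
  have hmoment : ∑ f : C, ‖𝔼 x, ψ (f.1 x)‖ ^ (8 * R) = Fintype.card C * N / (Z : ℝ) ^ (8 * R) := by
    simp_rw [Fintype.expect_eq_sum_div_card, norm_div, div_pow, Complex.norm_natCast]
    rw [← sum_div, show 8 * R = 2 * (4 * R) by ring, sum_norm_sum_pow_eq hψ]
  have hmarkov := unifProb_gt_mul_pow_le (C : Set ((σ → F) → F)) (fun f => ‖𝔼 x, ψ (f x)‖)
    (fun _ => norm_nonneg _) hε (8 * R)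
  have hC : (Fintype.card C : ℝ) ≠ 0 := Nat.cast_ne_zero.2 Fintype.card_ne_zero
  calc _ ≤ (∑ f : C, ‖𝔼 x, ψ (f.1 x)‖ ^ (8 * R)) / Fintype.card C * q ^ (Fintype.card α * R) := by
        gcongr
        exact hmarkov
    _ = N * q ^ (Fintype.card α * R) / (Z : ℝ) ^ (8 * R) := by
        rw [hmoment]
        field_simp
    _ ≤ 3 / 2 := by
        have : (2 * (N * q ^ (Fintype.card α * R)) : ℝ) ≤ 3 * Z ^ (8 * R) := by
          exact_mod_cast hcount
        have hZ : (0 : ℝ) < Z := Nat.cast_pos.2 Fintype.card_pos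
        rw [div_le_iff₀ (pow_pos hZ _)]
        linarith

end BiasBound

section Numerics

theorem exists_eq_add_add_of_le_mul {δ : ℝ} (hδ : δ < 1) {n D : ℕ}
    (hn : ((D + 1 : ℕ) : ℝ) ≤ δ * n) :
    ∃ m r : ℕ, m ≠ 0 ∧ n = m + (m + r) ∧ n ≤ 8 * (D + 1) * m ∧
      (m * D : ℝ) ≤ max δ (1 / 3) * (m + r : ℕ) := by
  obtain hlt | hle := lt_or_ge n (4 * (D + 1))
  · have hDn : D + 1 < n := by
      have hn0 : (0 : ℝ) < n := by
        rcases n.eq_zero_or_pos with rfl | h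
        · norm_num at hn; linarith
        · exact_mod_cast h
      exact_mod_cast hn.trans_lt (mul_lt_of_lt_one_left hn0 hδ)
    obtain ⟨r, rfl⟩ := Nat.exists_eq_add_of_le (by omega : 1 + 1 ≤ n)
    refine ⟨1, r, one_ne_zero, add_assoc _ _ _, by omega, ?_⟩
    push_cast at hn ⊢
    nlinarith [le_max_left δ (1 / 3), (Nat.cast_nonneg r : (0 : ℝ) ≤ r)]
  · obtain ⟨m, hm, hmn, hnm⟩ : ∃ m ≠ 0, m * (4 * (D + 1)) ≤ n ∧ n < (m + 1) * (4 * (D + 1)) :=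
      ⟨n / (4 * (D + 1)), (Nat.div_pos hle (by omega)).ne', Nat.div_mul_le_self _ _,
        Nat.lt_mul_of_div_lt (Nat.lt_succ_self _) (by omega)⟩
    obtain ⟨r, rfl⟩ := Nat.exists_eq_add_of_le (by nlinarith : m + m ≤ n)
    refine ⟨m, r, hm, add_assoc _ _ _, by nlinarith [Nat.pos_of_ne_zero hm], ?_⟩
    calc (m * D : ℝ) ≤ 1 / 3 * (m + r : ℕ) := by
          have : (m * (4 * (D + 1)) : ℝ) ≤ m + m + r := by exact_mod_cast hmn
          push_cast
          linarith
      _ ≤ _ := by gcongr; exact le_max_right _ _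

theorem card_reducedExponents_succ_le {σ : Type*} [Fintype σ] {q D m : ℕ} (hm : m ≠ 0)
    (hn : Fintype.card σ ≤ 8 * (D + 1) * m) :
    #(reducedExponents q σ (D + 1)) ≤ 10 * m * #(reducedExponents q σ D) := by
  refine Nat.le_of_mul_le_mul_left (succ_mul_card_reducedExponents_le.trans ?_) D.succ_pos
  rw [← mul_assoc]
  gcongr
  nlinarith [Nat.pos_of_ne_zero hm]

theorem sq_mul_card_reducedExponents_succ_le {σ : Type*} [Fintype σ] {q D m r : ℕ} (hm : m ≠ 0)
    (φ : Fin m ⊕ Fin (m + r) ≃ σ) (hn : Fintype.card σ ≤ 8 * (D + 1) * m) {ρ : ℝ} (hρ : ρ ≤ 1)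
    (hmr : (m * D : ℝ) ≤ ρ * (m + r : ℕ)) :
    (1 - ρ) ^ 2 * #(reducedExponents q σ (D + 1)) ≤ 10 * m * #(reducedExponents q (Fin r) D) := by
  have : NeZero m := ⟨hm⟩
  have : Nonempty σ := ⟨φ (.inl 0)⟩
  have hσ : Fintype.card σ = m + (m + r) := by simp [← Fintype.card_congr φ]
  have hρ0 : 0 ≤ ρ := nonneg_of_mul_nonneg_left ((by positivity : (0 : ℝ) ≤ m * D).trans hmr)
    (by positivity)
  have hdrop : (1 - ρ) * #(reducedExponents q σ D) ≤ #(reducedExponents q (Fin (m + r)) D) := by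
    refine one_sub_mul_card_reducedExponents_le φ ?_
    rw [Fintype.card_fin, hσ]
    exact hmr.trans (by gcongr; omega)
  have hdrop' : (1 - ρ) * #(reducedExponents q (Fin (m + r)) D) ≤ #(reducedExponents q (Fin r) D) :=
    one_sub_mul_card_reducedExponents_le finSumFinEquiv (by simpa using hmr)
  calc (1 - ρ) ^ 2 * #(reducedExponents q σ (D + 1))
      ≤ (1 - ρ) ^ 2 * (10 * m * #(reducedExponents q σ D)) := by
        gcongr
        exact_mod_cast card_reducedExponents_succ_le hm hn
    _ = 10 * m * ((1 - ρ) * ((1 - ρ) * #(reducedExponents q σ D))) := by ring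
    _ ≤ 10 * m * ((1 - ρ) * #(reducedExponents q (Fin (m + r)) D)) := by
        gcongr
    _ ≤ 10 * m * #(reducedExponents q (Fin r) D) := by gcongr

theorem le_rpow_of_mul_pow_mul_pow_le {P q a : ℝ} {m R : ℕ} (hq : 2 ≤ q) (hm : m ≠ 0) (hR : R ≠ 0)
    (ha : a ≤ m / 64) (h : P * (q ^ (-a)) ^ (8 * R) * q ^ (m * R) ≤ 3 / 2) :
    P ≤ q ^ (-(m * R / 8 : ℝ)) := by
  have hq0 : 0 < q := by linarith
  have hmR : (1 : ℝ) ≤ m * R := by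
    exact_mod_cast Nat.one_le_iff_ne_zero.2 (mul_ne_zero hm hR)
  have hnum : (3 / 2 : ℝ) ≤ q ^ (3 / 4 * (m * R) : ℝ) := by
    calc (3 / 2 : ℝ) ≤ (8 : ℝ) ^ (4⁻¹ : ℝ) := by
          rw [Real.le_rpow_inv_iff_of_pos (by norm_num) (by norm_num) (by norm_num)]
          norm_num
      _ = 2 ^ (3 / 4 : ℝ) := by
          rw [show (8 : ℝ) = 2 ^ (3 : ℝ) by norm_num, ← Real.rpow_mul (by norm_num)]
          norm_num
      _ ≤ q ^ (3 / 4 : ℝ) := by gcongr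
      _ ≤ q ^ (3 / 4 * (m * R) : ℝ) :=
          Real.rpow_le_rpow_of_exponent_le (by linarith) (by linarith)
  rw [← Real.rpow_mul_natCast hq0.le, ← Real.rpow_natCast, mul_assoc, ← Real.rpow_add hq0,
    ← le_div_iff₀ (by positivity)] at h
  refine h.trans ((div_le_iff₀ (by positivity)).2 (hnum.trans ?_))
  rw [← Real.rpow_add hq0]
  refine Real.rpow_le_rpow_of_exponent_le (by linarith) ?_
  have : a * (8 * R) ≤ m / 64 * (8 * R) := by gcongr
  push_cast
  linarith

end Numerics

section PrimeField

open MvPolynomial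
open scoped BigOperators

theorem unifProb_image_of_injOn {α β : Type*} {g : α → β} {S : Set α} (hg : Set.InjOn g S)
    (E : β → Prop) : unifProb (g '' S) E = unifProb S fun a => E (g a) := by
  have hE : {b | b ∈ g '' S ∧ E b} = g '' {a | a ∈ S ∧ E (g a)} := by
    ext b
    constructor
    · rintro ⟨⟨a, ha, rfl⟩, hb⟩
      exact ⟨a, ⟨ha, hb⟩, rfl⟩
    · rintro ⟨a, ⟨ha, hb⟩, rfl⟩
      exact ⟨⟨a, ha, rfl⟩, hb⟩
  rw [unifProb, unifProb, hE, hg.ncard_image, (hg.mono fun _ h => h.1).ncard_image]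

theorem bias_eq_expect (p n : ℕ) [NeZero p] (j : ZMod p) (f : (Fin n → ZMod p) → ZMod p) :
    bias p n j f = 𝔼 x, (ZMod.stdAddChar.mulShift j) (f x) := by
  simp [bias, Fintype.expect_eq_sum_div_card, div_eq_inv_mul, AddChar.mulShift_apply]

variable {p : ℕ} [Fact p.Prime]

theorem polys_eq_restrictSupport (d n : ℕ) :
    polys p d n = restrictSupport (ZMod p)
      (reducedExponents (Fintype.card (ZMod p)) (Fin n) d : Set (Fin n →₀ ℕ)) := by
  ext f
  rw [ZMod.card, coe_reducedExponents_fin]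
  exact mem_polys_iff (NeZero.pos p) f

theorem unifProb_polys_eq_unifProb_reedMuller (d n : ℕ) (E : ((Fin n → ZMod p) → ZMod p) → Prop) :
    unifProb (polys p d n) (fun f => E fun x => eval x f) =
      unifProb (reedMuller (ZMod p) (Fin n) d : Set ((Fin n → ZMod p) → ZMod p)) E := by
  rw [reedMuller_eq_map_restrictSupport, Submodule.map_coe,
    unifProb_image_of_injOn injOn_evalₗ_restrictSupport, polys_eq_restrictSupport]
  rfl

theorem finrank_reedMuller_eq_ncard_monomials (d n : ℕ) :
    finrank (ZMod p) (reedMuller (ZMod p) (Fin n) d) = (monomials p d n).ncard := by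
  rw [finrank_reedMuller, ZMod.card, ← coe_reducedExponents_fin, Set.ncard_coe_finset]

end PrimeField

end RMBias

open RMBias Finset Module in
open scoped BigOperators in
theorem theorem1_general (δ : ℝ) (hδ : δ < 1) : ∃ c₁ c₂ : ℝ, 0 < c₁ ∧ 0 < c₂ ∧
    ∀ (F σ : Type*) [Field F] [Fintype F] [Fintype σ] [DecidableEq σ] (ψ : AddChar F ℂ), ψ ≠ 1 →
      ∀ d : ℕ, 1 ≤ d → (d : ℝ) ≤ δ * Fintype.card σ →
        unifProb (reedMuller F σ d : Set ((σ → F) → F))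
            (fun f => ‖𝔼 x, ψ (f x)‖ >
              (Fintype.card F : ℝ) ^ (-(c₁ * Fintype.card σ / d)))
          ≤ (Fintype.card F : ℝ) ^ (-(c₂ * finrank F (reedMuller F σ d))) := by
  have hρ : 0 < 1 - max δ (1 / 3) := sub_pos.2 (max_lt hδ (by norm_num))
  refine ⟨1 / 512, (1 - max δ (1 / 3)) ^ 2 / 160, by norm_num, by positivity, ?_⟩
  intro F σ _ _ _ _ ψ hψ d hd hdσ
  obtain ⟨D, rfl⟩ := Nat.exists_eq_add_of_le' hd
  obtain ⟨m, r, hm, hσ, hσm, hmr⟩ := exists_eq_add_add_of_le_mul hδ hdσ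
  have : NeZero m := ⟨hm⟩
  let φ : Fin m ⊕ Fin (m + r) ≃ σ := Fintype.equivOfCardEq (by simp [hσ])
  have hpos : 0 < finrank F (reedMuller F (Fin r) D) := by
    rw [finrank_reedMuller]
    exact card_pos.2 ⟨0, zero_mem_reducedExponents Fintype.card_pos⟩
  obtain ⟨R, hR, hlt, hle⟩ : ∃ R ≠ 0, 2 * (R - 1) < finrank F (reedMuller F (Fin r) D)
      ∧ finrank F (reedMuller F (Fin r) D) ≤ 2 * R :=
    ⟨(finrank F (reedMuller F (Fin r) D) + 1) / 2, by omega, by omega, by omega⟩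
  have hq : (2 : ℝ) ≤ Fintype.card F := by exact_mod_cast Fintype.one_lt_card (α := F)
  have hsize := sq_mul_card_reducedExponents_succ_le (q := Fintype.card F) hm φ hσm
    (sub_pos.1 hρ).le hmr
  rw [← finrank_reedMuller, ← finrank_reedMuller] at hsize
  have hexp : 1 / 512 * (Fintype.card σ : ℝ) / (D + 1 : ℕ) ≤ m / 64 := by
    rw [div_le_iff₀ (by positivity)]
    have : (Fintype.card σ : ℝ) ≤ 8 * (D + 1 : ℕ) * m := by exact_mod_cast hσm
    linarith
  have hprob := unifProb_norm_expect_mul_le hψ φ (τ := Fin r) (by simp) hR hlt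
    (Real.rpow_nonneg (Nat.cast_nonneg (Fintype.card F))
      (-(1 / 512 * (Fintype.card σ : ℝ) / (D + 1 : ℕ))))
  rw [Fintype.card_fin] at hprob
  refine (le_rpow_of_mul_pow_mul_pow_le hq hm hR hexp hprob).trans
    (Real.rpow_le_rpow_of_exponent_le (by linarith) (neg_le_neg ?_))
  have hle' : (10 * m * finrank F (reedMuller F (Fin r) D) : ℝ) ≤ 10 * m * (2 * R) := by
    gcongr
    exact_mod_cast hle
  linarith

theorem theorem1 (δ : ℝ) (hδ0 : 0 < δ) (hδ : δ < 1 / 2) :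
    ∃ c₁ c₂ : ℝ, 0 < c₁ ∧ 0 < c₂ ∧
      ∀ (p : ℕ) [Fact p.Prime], p ≠ 2 →
        ∀ n d : ℕ, 1 ≤ d → (d : ℝ) ≤ δ * n →
          ∀ j : ZMod p, j ≠ 0 →
            RMBias.unifProb (RMBias.polys p d n)
                (fun f => ‖RMBias.bias p n j (fun x => MvPolynomial.eval x f)‖
                  > (p : ℝ) ^ (-(c₁ * (n : ℝ) / (d : ℝ))))
              ≤ (p : ℝ) ^ (-(c₂ * ((RMBias.monomials p d n).ncard : ℝ))) := by
  obtain ⟨c₁, c₂, hc₁, hc₂, hbound⟩ := theorem1_general δ (by linarith)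
  refine ⟨c₁, c₂, hc₁, hc₂, fun p _ _ n d hd hdn j hj => ?_⟩
  have h := hbound (ZMod p) (Fin n) (ZMod.stdAddChar.mulShift j)
    (ZMod.isPrimitive_stdAddChar p hj) d hd (by rwa [Fintype.card_fin])
  rw [← RMBias.unifProb_polys_eq_unifProb_reedMuller,
    RMBias.finrank_reedMuller_eq_ncard_monomials, ZMod.card, Fintype.card_fin] at h
  simpa only [RMBias.bias_eq_expect] using h
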